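/- Let $k\ge 3$ be an integer. For integers $m,n\ge 0$ let $$M(m,n)=\sum_{\substack{v_1,\dots,v_n\ge 2\\ v_1+\dots+v_n=m}}\frac{m!}{v_1!\cdots v_n!},\qquad N_0=M(km,n).$$ For $\bar l=(l_0,l_1,l_2)\in\mathbb{Z}_{\ge 0}^3$ with $l_0+l_1+l_2=km$ let $\mathcal K(\bar l)$ be the set of all $3\times m$ matrices $(k_{i,j})_{0\le i\le 2,\,1\le j\le m}$ of non-negative integers such that every column sums to $k$, $k_{1,j}\equiv k_{2,j}\pmod 3$ for every $j$, and $\sum_j k_{i,j}=l_i$ for $i=0,1,2$; and let $$K(\bar l)=\sum_{(k_{i,j})\in\mathcal K(\bar l)}\ \prod_{j=1}^m\frac{k!}{k_{0,j}!\,k_{1,j}!\,k_{2,j}!}.$$ For $\bar w=(w_0,w_1,w_2)\in\mathbb{Z}_{\ge 0}^3$ with $w_0+w_1+w_2=n$ let $$N(\bar w,\bar l)=\frac{n!}{w_0!\,w_1!\,w_2!}\;K(\bar l)\prod_{i=0}^{2}M(l_i,w_i),$$ and for $n,m\ge1$ write $\omega_i=w_i/n$ and $\lambda_i=l_i/(km)$.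 For $\varepsilon>0$ let $U_\varepsilon=\{(x,y)\in\mathbb{R}^2: |x-\tfrac13|<\varepsilon,\ |y-\tfrac13|<\varepsilon\}$. **Theorem.** Let $\gamma_0,\gamma_1$ be real constants with $k\gamma_0>2$ and $\gamma_1<1$. There are $\varepsilon>0$ and $C>0$ (depending only on $k,\gamma_0,\gamma_1$) such that for all $\gamma\in[\gamma_0,\gamma_1]$ and all integers $n\ge 1$ for which $m=\gamma n$ is an integer, $$\sum_{\substack{\bar w,\ \bar l:\\ (\omega_1,\omega_2)\in U_\varepsilon,\ (\lambda_1,\lambda_2)\in U_\varepsilon}}\frac{N(\bar w,\bar l)}{N_0}\;<\;C\cdot 3^{(1-\gamma)n},$$ where the sum is over all $\bar w,\bar l\in\mathbb{Z}_{\ge0}^3$ with $w_0+w_1+w_2=n$ and $l_0+l_1+l_2=km$ that satisfy the two stated conditions. -/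

import Mathlib

namespace ModThree

/-- `M(m, n) = ∑_{v_1, …, v_n ≥ 2, v_1 + ⋯ + v_n = m} m! / (v_1! ⋯ v_n!)`: the number of ways of
placing `n` variables into `m` slots such that every variable occurs at least twice. -/
def M (m n : ℕ) : ℕ :=
  ∑ v ∈ (Finset.piAntidiag (Finset.univ : Finset (Fin n)) m).filter (fun v => ∀ i, 2 ≤ v i),
    Nat.multinomial Finset.univ v

/-- `𝒦(l̄)`: the `3 × m` matrices `(k_{i,j})` of natural numbers all of whose columns sum to `k`,
with `k_{1,j} ≡ k_{2,j} (mod 3)` for every `j`, and whose `i`-th row sums to `l_i`.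
A matrix is given by its columns: `κ j i` is the entry `k_{i,j}`. -/
def matrices (k m : ℕ) (l : Fin 3 → ℕ) : Finset (Fin m → Fin 3 → ℕ) :=
  (Fintype.piFinset fun _ : Fin m => Finset.piAntidiag (Finset.univ : Finset (Fin 3)) k).filter
    (fun κ => (∀ j, κ j 1 ≡ κ j 2 [MOD 3]) ∧ ∀ i, ∑ j, κ j i = l i)

theorem mem_matrices {k m : ℕ} {l : Fin 3 → ℕ} {κ : Fin m → Fin 3 → ℕ} :
    κ ∈ matrices k m l ↔
      (∀ j, ∑ i, κ j i = k) ∧ (∀ j, κ j 1 ≡ κ j 2 [MOD 3]) ∧ ∀ i, ∑ j, κ j i = l i := by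
  simp [matrices]

/-- `K(l̄) = ∑_{(k_{i,j}) ∈ 𝒦(l̄)} ∏_j k! / (k_{0,j}! k_{1,j}! k_{2,j}!)`. -/
def K (k m : ℕ) (l : Fin 3 → ℕ) : ℕ :=
  ∑ κ ∈ matrices k m l, ∏ j, Nat.multinomial Finset.univ (κ j)

/-- `N̂(w̄, l̄) = K(l̄) · ∏_i M(l_i, w_i)`. -/
def Nhat (k m : ℕ) (w l : Fin 3 → ℕ) : ℕ :=
  K k m l * ∏ i, M (l i) (w i)

/-- `N(w̄, l̄) = n! / (w_0! w_1! w_2!) · N̂(w̄, l̄)`, where `n = w_0 + w_1 + w_2`. -/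
def N (k m : ℕ) (w l : Fin 3 → ℕ) : ℕ :=
  Nat.multinomial Finset.univ w * Nhat k m w l

/-- `N_0 = M(km, n)`. -/
def N₀ (k m n : ℕ) : ℕ := M (k * m) n

/-- The open square neighbourhood `𝒰_ε(a, b)` of `(a, b)`. -/
def openSquare (ε a b : ℝ) : Set (ℝ × ℝ) :=
  {p | |p.1 - a| < ε ∧ |p.2 - b| < ε}

open Classical in
/-- The pairs `(w̄, l̄)` of triples of natural numbers with `∑ w_i = n` and `∑ l_i = km` such that,
for `ω_i = w_i / n` and `λ_i = l_i / (km)`, both `(ω_1, ω_2)` and `(λ_1, λ_2)` lie in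
`𝒰_ε(1/3, 1/3)`. -/
noncomputable def localPairs (ε : ℝ) (k m n : ℕ) : Finset ((Fin 3 → ℕ) × (Fin 3 → ℕ)) :=
  (Finset.piAntidiag (Finset.univ : Finset (Fin 3)) n ×ˢ
      Finset.piAntidiag (Finset.univ : Finset (Fin 3)) (k * m)).filter
    (fun p =>
      ((p.1 1 : ℝ) / (n : ℝ), (p.1 2 : ℝ) / (n : ℝ)) ∈ openSquare ε (1 / 3) (1 / 3) ∧
      ((p.2 1 : ℝ) / ((k : ℝ) * (m : ℝ)), (p.2 2 : ℝ) / ((k : ℝ) * (m : ℝ))) ∈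
        openSquare ε (1 / 3) (1 / 3))

theorem mem_localPairs {ε : ℝ} {k m n : ℕ} {w l : Fin 3 → ℕ} :
    (w, l) ∈ localPairs ε k m n ↔
      (∑ i, w i = n ∧ ∑ i, l i = k * m) ∧
      (|(w 1 : ℝ) / n - 1 / 3| < ε ∧ |(w 2 : ℝ) / n - 1 / 3| < ε) ∧
      (|(l 1 : ℝ) / (k * m) - 1 / 3| < ε ∧ |(l 2 : ℝ) / (k * m) - 1 / 3| < ε) := by
  simp [localPairs, openSquare]

end ModThree

/-!
The idea is to compare the constrained count with the unconstrained one, in which `K(l̄)` is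
replaced by the full multinomial coefficient of `l̄`. With `f(z) = e^z - 1 - z` one has `M(L, n) =
L! [z^L] f(z)^n`, and with `L = k m` the unconstrained weights, summed over all `(w̄, l̄)`, give `L!
[z^L] (3 f(z))^n = 3^n N₀` (`sum_freeWeight`). So it is enough to know that `K(l̄)` is `O(3^{-m})`
times the multinomial coefficient, up to a factor whose mean under the unconstrained weights is
bounded.

*The column condition* (`K_le`). For `x_i = λ_i` the numbers `K(l̄) ∏ x_i^{l_i}` are coefficients of
`P^m`, where `P` is the generating polynomial of one column at the variables `x_i X_i`. Detecting
the congruence by cube roots of unity gives `P(1) ≤ (1 + 2 D^k) / 3`, where `D = ∑ |λ_i - 1/3|`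
(`eval_colPoly_le`, `norm_charSum_le`). Splitting off two independent symmetric two-point steps from
`P` shows that each coefficient of `P^m` is `O(P(1)^m / m)` (`coeff_pow_le`), which the Stirling
lower bound for the multinomial coefficient (`one_le_multinomial_mul`) matches. The remaining factor
is `exp (2 m D^k)`, and since `k ≥ 3` it is at most `exp (η ∑ (l_i - L/3)² / n)` in a window of size
`ε`, with `η` of order `ε` (`exponent_le`).

*The class sizes* (`sum_freeWeight_mul_exp_sq_le`). Such a factor has bounded mean once `l_i - L/3`
is sub-Gaussian with variance proxy `O(n)`. Its moment generating function at `s` is the quotient of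
the coefficients of `z^L` in the `n`-th powers of `∑_i f(e^{s a_i} z)`, with `∑ a_i = 0`, and of `3
f(z)`. The factors are exchanged one at a time: coefficientwise they agree up to `1 + O(s² d²
e^{d})`, and the large degrees `d` are harmless because the coefficients of the product of the other
factors do not decrease too fast. This follows from the inequality `F' ≥ r F` (`HasGrowth`), in
which `r` is additive under products. No saddle point analysis of `N₀` is needed, and no polynomial
factor is lost.
-/

namespace ModThree

open Finset PowerSeries

/-! ### The generating function of `M` -/

/-- The series `f(z) = ∑_{d ≥ 2} z^d / d! = e^z - 1 - z`, the exponential generating function of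
the number of slots filled by one variable. It is entered by its coefficients. -/
noncomputable def degSeries : ℝ⟦X⟧ :=
  PowerSeries.mk fun d => if 2 ≤ d then ((d.factorial : ℝ))⁻¹ else 0

theorem coeff_degSeries (d : ℕ) :
    coeff d degSeries = if 2 ≤ d then ((d.factorial : ℝ))⁻¹ else 0 := by
  simp [degSeries]

theorem coeff_degSeries_nonneg (d : ℕ) : 0 ≤ coeff d degSeries := by
  rw [coeff_degSeries]; split_ifs <;> positivity

theorem coeff_prod_eq_sum_piAntidiag {ι R : Type*} [Fintype ι] [DecidableEq ι] [CommSemiring R]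
    (F : ι → R⟦X⟧) (d : ℕ) :
    coeff d (∏ i, F i) = ∑ v ∈ piAntidiag (univ : Finset ι) d, ∏ i, coeff (v i) (F i) := by
  rw [coeff_prod]
  refine Finset.sum_bij' (fun v _ => ⇑v) (fun v _ => Finsupp.equivFunOnFinite.symm v) ?_ ?_ ?_ ?_ ?_
  · intro v hv; simpa using hv
  · intro v hv; simpa using hv
  · intro v _; ext; simp
  · intro v _; ext; simp
  · intro v _; rfl

theorem M_eq_coeff (m n : ℕ) : (M m n : ℝ) = m.factorial * coeff m (degSeries ^ n) := by
  have h : degSeries ^ n = ∏ _i : Fin n, degSeries := by simp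
  rw [h, coeff_prod_eq_sum_piAntidiag, M, Nat.cast_sum, Finset.sum_filter, Finset.mul_sum]
  refine Finset.sum_congr rfl fun v hv => ?_
  have hs : ∑ i, v i = m := by simpa using hv
  simp only [coeff_degSeries]
  by_cases h2 : ∀ i, 2 ≤ v i
  · have hm := Nat.multinomial_spec (s := univ) (f := v)
    rw [hs] at hm
    simp only [h2, implies_true, if_true, Finset.prod_inv_distrib]
    rw [← hm]
    push_cast
    field_simp [Nat.factorial_ne_zero]
  · obtain ⟨i, hi⟩ := not_forall.1 h2
    rw [if_neg h2, Finset.prod_eq_zero (Finset.mem_univ i) (if_neg hi), mul_zero]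

/-- The unconstrained version of the sum of `N(w̄, l̄)`, weighted by `∏ t_i^{l_i}`. Replacing
`K(l̄)` by the full multinomial coefficient makes the generating function factor. -/
theorem sum_multinomial_mul_prod_M (L n : ℕ) (t : Fin 3 → ℝ) :
    ∑ p ∈ piAntidiag (univ : Finset (Fin 3)) n ×ˢ piAntidiag (univ : Finset (Fin 3)) L,
      (Nat.multinomial univ p.1 : ℝ) * Nat.multinomial univ p.2 * (∏ i, (M (p.2 i) (p.1 i) : ℝ)) *
        ∏ i, t i ^ p.2 i =
      L.factorial * coeff L ((∑ i, rescale (t i) degSeries) ^ n) := by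
  rw [sum_pow_eq_sum_piAntidiag, map_sum, Finset.mul_sum, Finset.sum_product]
  refine Finset.sum_congr rfl fun w _ => ?_
  have hC : ((Nat.multinomial univ w : ℕ) : ℝ⟦X⟧) = C (Nat.multinomial univ w : ℝ) := by simp
  rw [hC, coeff_C_mul, coeff_prod_eq_sum_piAntidiag, Finset.mul_sum, Finset.mul_sum]
  refine Finset.sum_congr rfl fun l hl => ?_
  have hs : ∑ i, l i = L := by simpa using hl
  have hm := Nat.multinomial_spec (s := univ) (f := l)
  rw [hs] at hm
  simp only [M_eq_coeff, ← map_pow, coeff_rescale, Finset.prod_mul_distrib]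
  rw [← hm]
  push_cast
  ring

/-! ### Growth of coefficients -/

/-- `F` has nonnegative coefficients and `F' ≥ r F` coefficientwise. -/
def HasGrowth (r : ℝ) (F : ℝ⟦X⟧) : Prop :=
  ∀ j, 0 ≤ coeff j F ∧ r * coeff j F ≤ (j + 1) * coeff (j + 1) F

theorem HasGrowth.mono {r s : ℝ} {F : ℝ⟦X⟧} (h : HasGrowth r F) (hs : s ≤ r) : HasGrowth s F :=
  fun j => ⟨(h j).1, (mul_le_mul_of_nonneg_right hs (h j).1).trans (h j).2⟩

theorem HasGrowth.add {r : ℝ} {F G : ℝ⟦X⟧} (hF : HasGrowth r F) (hG : HasGrowth r G) :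
    HasGrowth r (F + G) := fun j => by
  have h1 := hF j
  have h2 := hG j
  simp only [map_add]
  exact ⟨by linarith, by linarith⟩

theorem coeff_mul_nonneg {F G : ℝ⟦X⟧} (hF : ∀ j, 0 ≤ coeff j F) (hG : ∀ j, 0 ≤ coeff j G) (j : ℕ) :
    0 ≤ coeff j (F * G) := by
  rw [coeff_mul]
  exact Finset.sum_nonneg fun p _ => mul_nonneg (hF _) (hG _)

/-- Growth rates add under multiplication, by the Leibniz rule. -/
theorem HasGrowth.mul {r s : ℝ} {F G : ℝ⟦X⟧} (hF : HasGrowth r F) (hG : HasGrowth s G) :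
    HasGrowth (r + s) (F * G) := fun j => by
  refine ⟨coeff_mul_nonneg (fun j => (hF j).1) (fun j => (hG j).1) j, ?_⟩
  have hd : (j + 1 : ℝ) * coeff (j + 1) (F * G) =
      coeff j (F * derivative ℝ G) + coeff j (G * derivative ℝ F) := by
    have h := congrArg (coeff j) ((derivative ℝ).leibniz F G)
    rw [coeff_derivative] at h
    rw [mul_comm, h]; simp
  rw [hd, add_mul, add_comm]
  refine add_le_add ?_ ?_
  · rw [coeff_mul, coeff_mul, Finset.mul_sum]
    refine Finset.sum_le_sum fun p _ => ?_
    rw [coeff_derivative]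
    nlinarith [mul_le_mul_of_nonneg_left (hG p.2).2 (hF p.1).1]
  · rw [mul_comm F G, coeff_mul, coeff_mul, Finset.mul_sum]
    refine Finset.sum_le_sum fun p _ => ?_
    rw [coeff_derivative]
    nlinarith [mul_le_mul_of_nonneg_left (hF p.2).2 (hG p.1).1]

theorem hasGrowth_one : HasGrowth 0 (1 : ℝ⟦X⟧) := fun j => by
  simp only [coeff_one]
  split_ifs <;> simp_all

theorem HasGrowth.pow {r : ℝ} {F : ℝ⟦X⟧} (hF : HasGrowth r F) (n : ℕ) :
    HasGrowth (n * r) (F ^ n) := by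
  induction n with
  | zero => simpa using hasGrowth_one
  | succ n ih =>
    have := ih.mul hF
    rw [pow_succ]
    convert this using 1
    push_cast; ring

theorem hasGrowth_rescale_degSeries {t : ℝ} (ht : 0 ≤ t) : HasGrowth t (rescale t degSeries) :=
  fun j => by
    simp only [coeff_rescale]
    refine ⟨mul_nonneg (pow_nonneg ht _) (coeff_degSeries_nonneg _), ?_⟩
    have h : coeff j degSeries ≤ (j + 1) * coeff (j + 1) degSeries := by
      simp only [coeff_degSeries]
      split_ifs with h1 h2 h2
      · rw [Nat.factorial_succ]; push_cast; field_simp; exact le_rfl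
      · omega
      · positivity
      · simp
    calc t * (t ^ j * coeff j degSeries) = t ^ (j + 1) * coeff j degSeries := by ring
      _ ≤ t ^ (j + 1) * ((j + 1) * coeff (j + 1) degSeries) := by gcongr
      _ = _ := by ring

/-- Going down from index `L` to `L - e` multiplies the coefficient by at most `B ^ e`. -/
theorem HasGrowth.coeff_le {r B : ℝ} {F : ℝ⟦X⟧} (hF : HasGrowth r F) (hr : 0 < r) {L : ℕ}
    (hB : (L : ℝ) ≤ B * r) {e : ℕ} (he : e ≤ L) :
    coeff (L - e) F ≤ B ^ e * coeff L F := by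
  have hB0 : 0 ≤ B := by
    by_contra h
    have := mul_neg_of_neg_of_pos (not_le.1 h) hr
    linarith [(Nat.cast_nonneg L : (0 : ℝ) ≤ L)]
  induction e with
  | zero => simp
  | succ e ih =>
    have h1 := hF (L - (e + 1))
    have h2 : L - (e + 1) + 1 = L - e := by omega
    have h3 : ((L - (e + 1) : ℕ) : ℝ) + 1 ≤ L := by
      have : L - (e + 1) + 1 ≤ L := by omega
      exact_mod_cast this
    rw [h2] at h1
    have h4 : r * coeff (L - (e + 1)) F ≤ r * (B * coeff (L - e) F) := by
      refine h1.2.trans ?_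
      have := mul_le_mul_of_nonneg_right (h3.trans hB) (hF (L - e)).1
      nlinarith
    have h5 := le_of_mul_le_mul_left h4 hr
    calc _ ≤ B * coeff (L - e) F := h5
      _ ≤ B * (B ^ e * coeff L F) := by gcongr; exact ih (by omega)
      _ = _ := by ring

end ModThree

namespace ModThree

open Finset PowerSeries

/-! ### The moment generating function of the class sizes -/

theorem exp_sub_one_sub_le (x : ℝ) : Real.exp x ≤ 1 + x + x ^ 2 * Real.exp |x| := by
  have h := Complex.norm_exp_sub_sum_le_norm_mul_exp x 2
  have h1 : Complex.exp x - ∑ m ∈ range 2, (x : ℂ) ^ m / m.factorial =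
      ((Real.exp x - (1 + x) : ℝ) : ℂ) := by
    simp [Finset.sum_range_succ]
  rw [h1, Complex.norm_real, Complex.norm_real, Real.norm_eq_abs, Real.norm_eq_abs, sq_abs] at h
  linarith [le_abs_self (Real.exp x - (1 + x))]

theorem sum_exp_mul_le {a : Fin 3 → ℝ} (ha0 : ∑ i, a i = 0) (ha1 : ∀ i, |a i| ≤ 1) (u : ℝ) :
    ∑ i, Real.exp (u * a i) ≤ 3 * (1 + u ^ 2 * Real.exp |u|) := by
  have h (i : Fin 3) : Real.exp (u * a i) ≤ 1 + u * a i + u ^ 2 * Real.exp |u| := by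
    refine (exp_sub_one_sub_le _).trans ?_
    have h1 : |u * a i| ≤ |u| := by
      rw [abs_mul]; exact mul_le_of_le_one_right (abs_nonneg _) (ha1 i)
    have h2 : (u * a i) ^ 2 ≤ u ^ 2 := sq_le_sq.2 h1
    gcongr
  refine (Finset.sum_le_sum fun i _ => h i).trans ?_
  rw [Finset.sum_add_distrib, Finset.sum_add_distrib, ← Finset.mul_sum, ha0]
  simp [mul_add]

/-- The exponential generating function `∑_i f(e^{s a_i} z)` of the number of slots filled by one
variable with a colour `i`, weighted by the factor `e^{s a_i}` per slot. -/
noncomputable def tiltSeries (a : Fin 3 → ℝ) (s : ℝ) : ℝ⟦X⟧ :=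
  ∑ i, rescale (Real.exp (s * a i)) degSeries

theorem coeff_tiltSeries (a : Fin 3 → ℝ) (s : ℝ) (d : ℕ) :
    coeff d (tiltSeries a s) = (∑ i, Real.exp (s * d * a i)) * coeff d degSeries := by
  simp only [tiltSeries, map_sum, coeff_rescale, Finset.sum_mul]
  refine Finset.sum_congr rfl fun i _ => ?_
  rw [← Real.exp_nat_mul]
  congr 2; ring

theorem coeff_tiltSeries_nonneg (a : Fin 3 → ℝ) (s : ℝ) (d : ℕ) :
    0 ≤ coeff d (tiltSeries a s) := by
  rw [coeff_tiltSeries]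
  exact mul_nonneg (Finset.sum_nonneg fun _ _ => (Real.exp_pos _).le) (coeff_degSeries_nonneg d)

theorem tiltSeries_zero (a : Fin 3 → ℝ) : tiltSeries a 0 = 3 * degSeries := by
  simp [tiltSeries]

theorem hasGrowth_tiltSeries {a : Fin 3 → ℝ} (ha1 : ∀ i, |a i| ≤ 1) {s : ℝ} (hs : |s| ≤ 1) :
    HasGrowth (Real.exp (-1)) (tiltSeries a s) := by
  have h (i : Fin 3) :
      HasGrowth (Real.exp (-1)) (rescale (Real.exp (s * a i)) degSeries) := by
    refine (hasGrowth_rescale_degSeries (Real.exp_pos _).le).mono (Real.exp_le_exp.2 ?_)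
    have : |s * a i| ≤ 1 := by
      rw [abs_mul]; exact mul_le_one₀ hs (abs_nonneg _) (ha1 i)
    exact (abs_le.1 this).1
  rw [tiltSeries, Fin.sum_univ_three]
  exact ((h 0).add (h 1)).add (h 2)

/-- Replacing one untilted factor by a tilted one costs a factor `1 + O(s²)`: the growth of `F`
makes the large degrees, for which the tilt is not close to `1`, negligible. -/
theorem coeff_tiltSeries_mul_le {a : Fin 3 → ℝ} (ha0 : ∑ i, a i = 0) (ha1 : ∀ i, |a i| ≤ 1)
    {s : ℝ} (hs : |s| ≤ 1) {r B : ℝ} {F : ℝ⟦X⟧} (hF : HasGrowth r F) (hr : 0 < r) {L : ℕ}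
    (hB1 : 1 ≤ B) (hB : (L : ℝ) ≤ B * r) :
    coeff L (tiltSeries a s * F) ≤
      (1 + s ^ 2 * (2 * Real.exp (4 * Real.exp 1 * B))) * coeff L (tiltSeries a 0 * F) := by
  have hFn := fun j => (hF j).1
  have hpt (d : ℕ) : coeff d (tiltSeries a s) ≤ coeff d (tiltSeries a 0) +
      3 * s ^ 2 * (d ^ 2 * Real.exp d * coeff d degSeries) := by
    rw [coeff_tiltSeries, coeff_tiltSeries]
    have h1 := sum_exp_mul_le ha0 ha1 (s * d)
    have h2 : Real.exp |s * d| ≤ Real.exp d := by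
      rw [abs_mul, Nat.abs_cast]
      exact Real.exp_le_exp.2 (mul_le_of_le_one_left (Nat.cast_nonneg d) hs)
    have h3 : ∑ i, Real.exp (s * d * a i) ≤ 3 * (1 + (s * d) ^ 2 * Real.exp d) :=
      h1.trans (by gcongr)
    have h4 := mul_le_mul_of_nonneg_right h3 (coeff_degSeries_nonneg d)
    refine h4.trans (le_of_eq ?_)
    simp
    ring
  rcases lt_or_ge L 2 with hL | hL
  · have hz (s' : ℝ) : coeff L (tiltSeries a s' * F) = 0 := by
      rw [coeff_mul]
      refine Finset.sum_eq_zero fun p hp => ?_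
      have : p.1 + p.2 = L := by simpa using hp
      rw [coeff_tiltSeries, coeff_degSeries, if_neg (by omega)]
      simp
    rw [hz, hz, mul_zero]
  -- Passing to the index `L - 2`, which corresponds to the smallest degree `2`, costs
  -- `B ^ (d - 2)`, and the factorial in the coefficient of `f` absorbs all powers.
  have hmain : ∑ d ∈ range (L + 1), (d : ℝ) ^ 2 * Real.exp d * coeff d degSeries * coeff (L - d) F ≤
      Real.exp (4 * Real.exp 1 * B) * coeff (L - 2) F := by
    refine le_trans ?_ (mul_le_mul_of_nonneg_right
      (Real.sum_le_exp_of_nonneg (x := 4 * Real.exp 1 * B) (by positivity) (L + 1)) (hFn _))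
    rw [Finset.sum_mul]
    refine Finset.sum_le_sum fun d hd => ?_
    have hdL : d ≤ L := by simpa [Nat.lt_succ_iff] using hd
    rw [coeff_degSeries]
    split_ifs with h2
    · have e1 : coeff (L - d) F ≤ B ^ d * coeff (L - 2) F := by
        have h5 := hF.coeff_le hr (L := L - 2) (B := B) (e := d - 2)
          (le_trans (by exact_mod_cast Nat.sub_le _ _) hB) (by omega)
        rw [show L - 2 - (d - 2) = L - d by omega] at h5
        refine h5.trans (mul_le_mul_of_nonneg_right ?_ (hFn _))
        exact pow_le_pow_right₀ hB1 (Nat.sub_le _ _)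
      have e2 : (d : ℝ) ^ 2 ≤ 4 ^ d := by
        have : (d : ℝ) ≤ 2 ^ d := by exact_mod_cast Nat.lt_two_pow_self.le
        calc (d : ℝ) ^ 2 ≤ (2 ^ d) ^ 2 := by gcongr
          _ = 4 ^ d := by rw [← pow_mul, mul_comm, pow_mul]; norm_num
      have e3 : Real.exp d = Real.exp 1 ^ d := by rw [← Real.exp_nat_mul]; simp
      calc (d : ℝ) ^ 2 * Real.exp d * ((d.factorial : ℝ))⁻¹ * coeff (L - d) F
          ≤ 4 ^ d * Real.exp d * ((d.factorial : ℝ))⁻¹ * (B ^ d * coeff (L - 2) F) := by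
            gcongr; exact hFn _
        _ = _ := by rw [e3, mul_pow, mul_pow]; field_simp
    · simp only [mul_zero, zero_mul]
      exact mul_nonneg (by positivity) (hFn _)
  have htwo : 3 * coeff (L - 2) F ≤ 2 * coeff L (tiltSeries a 0 * F) := by
    rw [coeff_mul, Finset.Nat.sum_antidiagonal_eq_sum_range_succ_mk]
    have h := Finset.single_le_sum (s := range L.succ)
      (f := fun d => coeff d (tiltSeries a 0) * coeff (L - d) F)
      (fun d _ => mul_nonneg (coeff_tiltSeries_nonneg _ _ _) (hFn _))
      (Finset.mem_range.2 (show 2 < L.succ by omega))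
    have h2 : coeff 2 (tiltSeries a 0) = 3 / 2 := by
      rw [coeff_tiltSeries, coeff_degSeries]; simp; norm_num
    simp only [h2] at h
    linarith
  have hsplit : coeff L (tiltSeries a s * F) ≤ coeff L (tiltSeries a 0 * F) + 3 * s ^ 2 *
      ∑ d ∈ range (L + 1), (d : ℝ) ^ 2 * Real.exp d * coeff d degSeries * coeff (L - d) F := by
    rw [coeff_mul, coeff_mul, Finset.Nat.sum_antidiagonal_eq_sum_range_succ_mk,
      Finset.Nat.sum_antidiagonal_eq_sum_range_succ_mk, Finset.mul_sum, ← Finset.sum_add_distrib]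
    refine Finset.sum_le_sum fun d _ => ?_
    have := mul_le_mul_of_nonneg_right (hpt d) (hFn (L - d))
    simp only
    linarith
  have h6 : 3 * s ^ 2 * ∑ d ∈ range (L + 1),
      (d : ℝ) ^ 2 * Real.exp d * coeff d degSeries * coeff (L - d) F ≤
      s ^ 2 * Real.exp (4 * Real.exp 1 * B) * (3 * coeff (L - 2) F) := by
    have := mul_le_mul_of_nonneg_left hmain (show 0 ≤ 3 * s ^ 2 by positivity)
    linarith
  have h7 := mul_le_mul_of_nonneg_left htwo
    (show 0 ≤ s ^ 2 * Real.exp (4 * Real.exp 1 * B) by positivity)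
  linarith

theorem coeff_tiltSeries_pow_le {a : Fin 3 → ℝ} (ha0 : ∑ i, a i = 0) (ha1 : ∀ i, |a i| ≤ 1)
    {s : ℝ} (hs : |s| ≤ 1) {B : ℝ} (hB1 : 1 ≤ B) {L n : ℕ} (hn : 2 ≤ n)
    (hB : (L : ℝ) ≤ B * ((n - 1 : ℕ) * Real.exp (-1))) :
    coeff L (tiltSeries a s ^ n) ≤
      Real.exp (2 * Real.exp (4 * Real.exp 1 * B) * n * s ^ 2) * coeff L (tiltSeries a 0 ^ n) := by
  set D := 2 * Real.exp (4 * Real.exp 1 * B) with hD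
  have hDp : 0 < D := by positivity
  -- The tilted factors are introduced one at a time.
  have hh (i : ℕ) (hi : i ≤ n) : coeff L (tiltSeries a s ^ i * tiltSeries a 0 ^ (n - i)) ≤
      (1 + s ^ 2 * D) ^ i * coeff L (tiltSeries a 0 ^ n) := by
    induction i with
    | zero => simp
    | succ i ih =>
      have hg : HasGrowth ((n - 1 : ℕ) * Real.exp (-1))
          (tiltSeries a s ^ i * tiltSeries a 0 ^ (n - (i + 1))) := by
        have := ((hasGrowth_tiltSeries ha1 hs).pow i).mul
          ((hasGrowth_tiltSeries ha1 (s := 0) (by simp)).pow (n - (i + 1)))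
        rw [← add_mul, ← Nat.cast_add, show i + (n - (i + 1)) = n - 1 by omega] at this
        exact this
      have hpos : 0 < ((n - 1 : ℕ) : ℝ) * Real.exp (-1) := by
        have : 0 < n - 1 := by omega
        positivity
      have h1 := coeff_tiltSeries_mul_le ha0 ha1 hs hg hpos hB1 hB
      rw [← hD, ← mul_assoc (tiltSeries a s), ← pow_succ',
        mul_left_comm (tiltSeries a 0), ← pow_succ',
        show n - (i + 1) + 1 = n - i by omega] at h1
      calc _ ≤ _ := h1
        _ ≤ (1 + s ^ 2 * D) * ((1 + s ^ 2 * D) ^ i * coeff L (tiltSeries a 0 ^ n)) := by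
          gcongr; exact ih (by omega)
        _ = _ := by ring
  have h := hh n le_rfl
  simp only [Nat.sub_self, pow_zero, mul_one] at h
  refine h.trans (mul_le_mul_of_nonneg_right ?_ ?_)
  · calc (1 + s ^ 2 * D) ^ n ≤ Real.exp (s ^ 2 * D) ^ n := by
          gcongr; linarith [Real.add_one_le_exp (s ^ 2 * D)]
      _ = _ := by rw [← Real.exp_nat_mul]; congr 1; ring
  · exact (((hasGrowth_tiltSeries ha1 (s := 0) (by simp)).pow n) L).1

/-- The unconstrained weight of the pair `(w̄, l̄)`: the number of ways to split the variables into
classes of sizes `w̄` and the slots into classes of sizes `l̄`, and to fill the slots of each class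
with variables of that class, every variable occurring at least twice. -/
noncomputable def freeWeight (p : (Fin 3 → ℕ) × (Fin 3 → ℕ)) : ℝ :=
  (Nat.multinomial univ p.1 : ℝ) * Nat.multinomial univ p.2 * ∏ i, (M (p.2 i) (p.1 i) : ℝ)

theorem freeWeight_nonneg (p : (Fin 3 → ℕ) × (Fin 3 → ℕ)) : 0 ≤ freeWeight p := by
  unfold freeWeight; positivity

/-- The pairs `(w̄, l̄)` with `∑ w_i = n` and `∑ l_i = L`. -/
def allPairs (L n : ℕ) : Finset ((Fin 3 → ℕ) × (Fin 3 → ℕ)) :=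
  piAntidiag univ n ×ˢ piAntidiag univ L

theorem mem_allPairs {L n : ℕ} {p : (Fin 3 → ℕ) × (Fin 3 → ℕ)} :
    p ∈ allPairs L n ↔ ∑ i, p.1 i = n ∧ ∑ i, p.2 i = L := by
  simp [allPairs]

theorem sum_freeWeight_mul_exp (a : Fin 3 → ℝ) (s : ℝ) (L n : ℕ) :
    ∑ p ∈ allPairs L n, freeWeight p * Real.exp (s * ∑ i, a i * p.2 i) =
      L.factorial * coeff L (tiltSeries a s ^ n) := by
  rw [tiltSeries, ← sum_multinomial_mul_prod_M]
  refine Finset.sum_congr rfl fun p _ => ?_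
  rw [freeWeight, Finset.mul_sum, Real.exp_sum]
  congr 1
  refine Finset.prod_congr rfl fun i _ => ?_
  rw [← Real.exp_nat_mul]; congr 1; ring

theorem sum_freeWeight (L n : ℕ) :
    ∑ p ∈ allPairs L n, freeWeight p = 3 ^ n * (M L n : ℝ) := by
  have h := sum_freeWeight_mul_exp 0 0 L n
  have h3 : (3 : ℝ⟦X⟧) ^ n = C ((3 : ℝ) ^ n) := by rw [map_pow, map_ofNat]
  rw [tiltSeries_zero, mul_pow, h3, coeff_C_mul] at h
  rw [M_eq_coeff]
  simp only [zero_mul, Real.exp_zero, mul_one] at h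
  rw [h]; ring

/-- Under the unconstrained weights a centred linear function of `l̄` is sub-Gaussian with variance
proxy `O(n)`. -/
theorem sum_freeWeight_mul_exp_le {a : Fin 3 → ℝ} (ha0 : ∑ i, a i = 0) (ha1 : ∀ i, |a i| ≤ 1)
    {B : ℝ} (hB1 : 1 ≤ B) {L n : ℕ} (hn : 2 ≤ n) (hLB : (L : ℝ) ≤ B * n)
    (hB : (L : ℝ) ≤ B * ((n - 1 : ℕ) * Real.exp (-1))) (s : ℝ) :
    ∑ p ∈ allPairs L n, freeWeight p * Real.exp (s * ∑ i, a i * p.2 i) ≤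
      3 ^ n * (M L n : ℝ) * Real.exp (2 * Real.exp (4 * Real.exp 1 * B) * n * s ^ 2) := by
  rcases le_total |s| 1 with hs | hs
  · have h0 := sum_freeWeight_mul_exp a 0 L n
    simp only [zero_mul, Real.exp_zero, mul_one, sum_freeWeight] at h0
    rw [sum_freeWeight_mul_exp, h0, mul_assoc, mul_comm (coeff L _)]
    exact mul_le_mul_of_nonneg_left (coeff_tiltSeries_pow_le ha0 ha1 hs hB1 hn hB) (by positivity)
  -- For `|s| ≥ 1` the trivial bound `|∑ a_i l_i| ≤ L ≤ B n` suffices.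
  · rw [← sum_freeWeight, Finset.sum_mul]
    refine Finset.sum_le_sum fun p hp => ?_
    refine mul_le_mul_of_nonneg_left (Real.exp_le_exp.2 ?_) (freeWeight_nonneg p)
    have hL : ∑ i, (p.2 i : ℝ) = L := by exact_mod_cast (mem_allPairs.1 hp).2
    have h1 : |∑ i, a i * p.2 i| ≤ L := by
      rw [← hL]
      refine (Finset.abs_sum_le_sum_abs _ _).trans (Finset.sum_le_sum fun i _ => ?_)
      rw [abs_mul, Nat.abs_cast]
      exact mul_le_of_le_one_left (Nat.cast_nonneg _) (ha1 i)
    have h2 : |s| ≤ s ^ 2 := by rw [← sq_abs]; nlinarith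
    have h3 : B ≤ 2 * Real.exp (4 * Real.exp 1 * B) := by
      have := Real.add_one_le_exp (4 * Real.exp 1 * B)
      have := Real.add_one_le_exp (1 : ℝ)
      nlinarith
    calc s * ∑ i, a i * p.2 i ≤ |s| * |∑ i, a i * p.2 i| := by
          rw [← abs_mul]; exact le_abs_self _
      _ ≤ s ^ 2 * (B * n) := by gcongr; exact h1.trans hLB
      _ ≤ s ^ 2 * (2 * Real.exp (4 * Real.exp 1 * B) * n) := by gcongr
      _ = _ := by ring

/-! ### From the moment generating function to the exponential of a square -/

/-- Integrating the hypothesis against a Gaussian density in `s` turns `e^{sX}` into the exponential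
of a multiple of `X²`. -/
theorem sum_exp_sq_le_of_subgaussian {ι : Type*} (S : Finset ι) (μ Y : ι → ℝ) {W c : ℝ} (hc : 0 < c)
    (h : ∀ s : ℝ, ∑ p ∈ S, μ p * Real.exp (s * Y p) ≤ W * Real.exp (c * s ^ 2)) :
    ∑ p ∈ S, μ p * Real.exp (Y p ^ 2 / (8 * c)) ≤ √2 * W := by
  have hint (y : ℝ) : MeasureTheory.Integrable
      (fun s : ℝ => Real.exp (-(2 * c) * (s - y / (4 * c)) ^ 2)) :=
    (integrable_exp_neg_mul_sq (b := 2 * c) (by positivity)).comp_sub_right _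
  have hsq (y s : ℝ) : Real.exp (-(2 * c) * s ^ 2) * Real.exp (s * y) =
      Real.exp (y ^ 2 / (8 * c)) * Real.exp (-(2 * c) * (s - y / (4 * c)) ^ 2) := by
    rw [← Real.exp_add, ← Real.exp_add]
    congr 1; field_simp; ring
  have hval (y : ℝ) : ∫ s : ℝ, Real.exp (-(2 * c) * s ^ 2) * Real.exp (s * y) =
      Real.exp (y ^ 2 / (8 * c)) * √(Real.pi / (2 * c)) := by
    simp_rw [hsq]
    rw [MeasureTheory.integral_const_mul,
      MeasureTheory.integral_sub_right_eq_self (fun s : ℝ => Real.exp (-(2 * c) * s ^ 2)),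
      integral_gaussian]
  have hI (y : ℝ) : MeasureTheory.Integrable
      (fun s : ℝ => Real.exp (-(2 * c) * s ^ 2) * Real.exp (s * y)) := by
    simp_rw [hsq]; exact (hint y).const_mul _
  have hle : ∫ s : ℝ, ∑ p ∈ S, μ p * (Real.exp (-(2 * c) * s ^ 2) * Real.exp (s * Y p)) ≤
      ∫ s : ℝ, W * Real.exp (-c * s ^ 2) := by
    refine MeasureTheory.integral_mono
      (MeasureTheory.integrable_finsetSum _ fun p _ => (hI (Y p)).const_mul _)
      ((integrable_exp_neg_mul_sq hc).const_mul _) fun s => ?_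
    have h1 := mul_le_mul_of_nonneg_left (h s) (Real.exp_pos (-(2 * c) * s ^ 2)).le
    have h2 : Real.exp (-(2 * c) * s ^ 2) * (W * Real.exp (c * s ^ 2)) =
        W * Real.exp (-c * s ^ 2) := by
      rw [mul_left_comm, ← Real.exp_add]; congr 2; ring
    rw [h2, Finset.mul_sum] at h1
    refine le_trans (le_of_eq ?_) h1
    exact Finset.sum_congr rfl fun p _ => by ring
  rw [MeasureTheory.integral_finsetSum _ fun p _ => (hI (Y p)).const_mul _,
    MeasureTheory.integral_const_mul, integral_gaussian] at hle
  simp_rw [MeasureTheory.integral_const_mul, hval] at hle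
  have hroot : √(Real.pi / c) = √2 * √(Real.pi / (2 * c)) := by
    rw [← Real.sqrt_mul (by norm_num)]; congr 1; field_simp
  have hpos : 0 < √(Real.pi / (2 * c)) := by positivity
  rw [hroot] at hle
  refine le_of_mul_le_mul_right ?_ hpos
  rw [Finset.sum_mul]
  calc _ = _ := Finset.sum_congr rfl fun p _ => by ring
    _ ≤ _ := hle
    _ = _ := by ring

end ModThree

namespace ModThree

open Finset

/-! ### Binomial coefficients -/

theorem succ_mul_centralBinom_sq_le (n : ℕ) : (2 * n + 1) * n.centralBinom ^ 2 ≤ 16 ^ n := by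
  induction n with
  | zero => simp
  | succ n ih =>
    have h := Nat.succ_mul_centralBinom_succ n
    have h2 : (n + 1) ^ 2 * ((2 * (n + 1) + 1) * (n + 1).centralBinom ^ 2) =
        4 * (2 * n + 1) * (2 * n + 3) * ((2 * n + 1) * n.centralBinom ^ 2) := by
      calc _ = (2 * n + 3) * ((n + 1) * (n + 1).centralBinom) ^ 2 := by ring
        _ = _ := by rw [h]; ring
    have h3 : 4 * (2 * n + 1) * (2 * n + 3) ≤ 16 * (n + 1) ^ 2 := by nlinarith
    have h4 : (n + 1) ^ 2 * ((2 * (n + 1) + 1) * (n + 1).centralBinom ^ 2) ≤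
        (n + 1) ^ 2 * 16 ^ (n + 1) := by
      rw [h2]
      calc _ ≤ 16 * (n + 1) ^ 2 * 16 ^ n := Nat.mul_le_mul h3 ih
        _ = _ := by ring
    exact Nat.le_of_mul_le_mul_left h4 (by positivity)

theorem choose_sq_mul_succ_le (b j : ℕ) : b.choose j ^ 2 * (b + 1) ≤ 4 ^ b := by
  have h := Nat.choose_le_middle j b
  have h2 : b.choose j ^ 2 * (b + 1) ≤ b.choose (b / 2) ^ 2 * (b + 1) := by gcongr
  refine h2.trans ?_
  rcases Nat.even_or_odd' b with ⟨n, rfl | rfl⟩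
  · have := succ_mul_centralBinom_sq_le n
    rw [Nat.centralBinom] at this
    rw [show 2 * n / 2 = n by omega, pow_mul 4]
    norm_num
    linarith
  · have := succ_mul_centralBinom_sq_le (n + 1)
    have h3 : (n + 1).centralBinom = 2 * (2 * n + 1).choose n := by
      rw [Nat.centralBinom, show 2 * (n + 1) = 2 * n + 1 + 1 by ring, Nat.choose_succ_succ,
        Nat.choose_symm_half]
      ring
    rw [h3] at this
    rw [show (2 * n + 1) / 2 = n by omega, pow_succ 4, pow_mul 4]
    rw [pow_succ 16] at this
    norm_num at this ⊢
    nlinarith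

/-- The product of two point probabilities of symmetric binomial laws, with the geometric mean of
the two decay rates replaced by the arithmetic one. -/
theorem choose_mul_choose_le (b c i j : ℕ) :
    (b.choose i : ℝ) * c.choose j ≤
      2 ^ b * 2 ^ c * ((1 / (b + 1) + 1 / (c + 1)) / 2) := by
  have h (b i : ℕ) : ((b.choose i : ℝ) / 2 ^ b) ^ 2 ≤ 1 / (b + 1) := by
    rw [div_pow, div_le_div_iff₀ (by positivity) (by positivity), one_mul, ← pow_mul, mul_comm b 2,
      pow_mul]
    have := choose_sq_mul_succ_le b i
    norm_num
    exact_mod_cast this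
  have h1 := h b i
  have h2 := h c j
  have h3 := two_mul_le_add_sq ((b.choose i : ℝ) / 2 ^ b) ((c.choose j : ℝ) / 2 ^ c)
  have h4 : (b.choose i : ℝ) * c.choose j =
      2 ^ b * 2 ^ c * (((b.choose i : ℝ) / 2 ^ b) * ((c.choose j : ℝ) / 2 ^ c)) := by field_simp
  rw [h4]
  gcongr
  linarith

/-- A bound for the expectation of `1 / (b + 1)` for a binomial variable `b`, not normalized. -/
theorem sum_choose_div_succ_le {q r : ℝ} (hq : 0 < q) (hr : 0 ≤ r) (m : ℕ) :
    ∑ b ∈ range (m + 1), (m.choose b : ℝ) * q ^ b * r ^ (m - b) * (1 / (b + 1)) ≤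
      (q + r) ^ (m + 1) / ((m + 1) * q) := by
  rw [le_div_iff₀ (by positivity), add_pow, Finset.sum_mul, Finset.sum_range_succ' _ (m + 1)]
  refine le_trans (Finset.sum_le_sum fun b _ => le_of_eq ?_)
    (le_add_of_nonneg_right (by positivity))
  have h : ((m : ℝ) + 1) * m.choose b = (m + 1).choose (b + 1) * (b + 1) := by
    exact_mod_cast Nat.add_one_mul_choose_eq m b
  rw [Nat.add_sub_add_right]
  field_simp
  linear_combination (q * q ^ b * r ^ (m - b)) * h

/-- A bound for the expectation of `1 / (b + 1) + 1 / (c + 1)` for two components `b`, `c` of a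
multinomial variable, not normalized. -/
theorem sum_choose_choose_le {q r : ℝ} (hq : 0 < q) (hr : 0 ≤ r) (m : ℕ) :
    ∑ b ∈ range (m + 1), ∑ c ∈ range (m - b + 1), (m.choose b : ℝ) * (m - b).choose c *
      (q ^ b * q ^ c) * r ^ (m - b - c) * (1 / (b + 1) + 1 / (c + 1)) ≤
      2 * ((2 * q + r) ^ (m + 1) / ((m + 1) * q)) := by
  have e1 : ∑ b ∈ range (m + 1), ∑ c ∈ range (m - b + 1), (m.choose b : ℝ) * (m - b).choose c *
      (q ^ b * q ^ c) * r ^ (m - b - c) * (1 / (b + 1)) =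
      ∑ b ∈ range (m + 1), (m.choose b : ℝ) * q ^ b * (q + r) ^ (m - b) * (1 / (b + 1)) := by
    refine Finset.sum_congr rfl fun b _ => ?_
    rw [add_pow, Finset.mul_sum, Finset.sum_mul]
    exact Finset.sum_congr rfl fun c _ => by ring
  have e2 : ∑ b ∈ range (m + 1), ∑ c ∈ range (m - b + 1), (m.choose b : ℝ) * (m - b).choose c *
      (q ^ b * q ^ c) * r ^ (m - b - c) * (1 / (c + 1)) ≤
      ∑ b ∈ range (m + 1), (m.choose b : ℝ) * q ^ b *
        ((q + r) ^ (m - b + 1) / (((m - b : ℕ) + 1) * q)) := by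
    refine Finset.sum_le_sum fun b _ => ?_
    calc _ = (m.choose b : ℝ) * q ^ b * ∑ c ∈ range (m - b + 1),
          ((m - b).choose c : ℝ) * q ^ c * r ^ (m - b - c) * (1 / (c + 1)) := by
          rw [Finset.mul_sum]; exact Finset.sum_congr rfl fun c _ => by ring
      _ ≤ _ := by gcongr; exact sum_choose_div_succ_le hq hr _
  have e3 : ∑ b ∈ range (m + 1), (m.choose b : ℝ) * q ^ b *
        ((q + r) ^ (m - b + 1) / (((m - b : ℕ) + 1) * q)) =
      (q + r) / q * ∑ b ∈ range (m + 1),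
        (m.choose b : ℝ) * (q + r) ^ b * q ^ (m - b) * (1 / (b + 1)) := by
    rw [← Finset.sum_range_reflect, Finset.mul_sum]
    refine Finset.sum_congr rfl fun b hb => ?_
    have hb' : b ≤ m := by simpa [Nat.lt_succ_iff] using hb
    rw [show m + 1 - 1 - b = m - b by omega, show m - (m - b) = b by omega, Nat.choose_symm hb',
      pow_succ]
    field_simp
  have b1 := sum_choose_div_succ_le hq (add_nonneg hq.le hr) m
  have b2 := sum_choose_div_succ_le (add_pos_of_pos_of_nonneg hq hr) hq.le m
  have b3 := mul_le_mul_of_nonneg_left b2 (show 0 ≤ (q + r) / q by positivity)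
  simp_rw [mul_add, Finset.sum_add_distrib]
  rw [e1]
  have h4 : (q + r) / q * ((q + r + q) ^ (m + 1) / ((m + 1) * (q + r))) =
      (2 * q + r) ^ (m + 1) / ((m + 1) * q) := by
    have : q + r ≠ 0 := by positivity
    rw [show q + r + q = 2 * q + r by ring]
    field_simp
  rw [h4] at b3
  rw [show q + (q + r) = 2 * q + r by ring] at b1
  linarith [e2.trans (e3.le.trans b3)]

/-! ### A local limit bound for coefficients of powers -/

open MvPolynomial

section LocalLimit

variable {σ : Type*}

theorem mvCoeff_mul_nonneg {F G : MvPolynomial σ ℝ} (hF : ∀ d, 0 ≤ coeff d F)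
    (hG : ∀ d, 0 ≤ coeff d G) (d : σ →₀ ℕ) : 0 ≤ coeff d (F * G) := by
  classical
  rw [coeff_mul]
  exact Finset.sum_nonneg fun p _ => mul_nonneg (hF _) (hG _)

theorem mvCoeff_pow_nonneg {F : MvPolynomial σ ℝ} (hF : ∀ d, 0 ≤ coeff d F) (n : ℕ)
    (d : σ →₀ ℕ) : 0 ≤ coeff d (F ^ n) := by
  classical
  induction n generalizing d with
  | zero => rw [pow_zero, coeff_one]; split_ifs <;> simp
  | succ n ih => rw [pow_succ]; exact mvCoeff_mul_nonneg ih hF d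

/-- The `ℓ^∞`–`ℓ^1` bound for the coefficients of a product. -/
theorem mvCoeff_mul_le {F G : MvPolynomial σ ℝ} {A : ℝ} (hA : 0 ≤ A) (hF : ∀ d, coeff d F ≤ A)
    (hG : ∀ d, 0 ≤ coeff d G) (d : σ →₀ ℕ) :
    coeff d (F * G) ≤ A * eval (fun _ => 1) G := by
  classical
  rw [coeff_mul]
  have h1 : ∑ p ∈ antidiagonal d, coeff p.1 F * coeff p.2 G ≤
      ∑ p ∈ antidiagonal d, A * coeff p.2 G :=
    Finset.sum_le_sum fun p _ => mul_le_mul_of_nonneg_right (hF _) (hG _)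
  refine h1.trans ?_
  rw [← Finset.mul_sum]
  refine mul_le_mul_of_nonneg_left ?_ hA
  have h2 : eval (fun _ => (1 : ℝ)) G = ∑ e ∈ G.support, coeff e G := by
    rw [eval_eq]; simp
  have hinj : Set.InjOn Prod.snd (antidiagonal d : Set ((σ →₀ ℕ) × (σ →₀ ℕ))) := by
    rintro ⟨p, q⟩ hp ⟨p', q'⟩ hp' h
    have h3 : p + q = d := by simpa using hp
    have h4 : p' + q' = d := by simpa using hp'
    simp only at h
    subst h
    rw [add_right_cancel (h3.trans h4.symm)]
  rw [h2, ← Finset.sum_image (f := fun e => coeff e G) hinj]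
  rw [← Finset.sum_filter_add_sum_filter_not _ (fun e => e ∈ G.support)]
  have h5 : ∑ e ∈ ((antidiagonal d).image Prod.snd).filter (fun e => e ∉ G.support),
      coeff e G = 0 :=
    Finset.sum_eq_zero fun e he => by simpa using (Finset.mem_filter.1 he).2
  rw [h5, add_zero]
  exact Finset.sum_le_sum_of_subset_of_nonneg (fun e he => (Finset.mem_filter.1 he).2)
    fun e _ _ => hG e

theorem monomial_add_monomial_pow (u v : σ →₀ ℕ) (b : ℕ) :
    (monomial v (1 : ℝ) + monomial u 1) ^ b =
      ∑ i ∈ range (b + 1), monomial (i • v + (b - i) • u) (b.choose i : ℝ) := by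
  rw [add_pow]
  refine Finset.sum_congr rfl fun i _ => ?_
  have h : (((b.choose i : ℕ)) : MvPolynomial σ ℝ) = C (b.choose i : ℝ) := by simp
  rw [monomial_pow, monomial_pow, monomial_mul, h, mul_comm, C_mul_monomial]
  simp

/-- If `u`, `v`, `w` are exponents whose differences `v - u`, `w - u` have the independent
components `(e, 0)` and `(0, e)` at the coordinates `x`, `y`, then the coefficients of
`(X^v + X^u)^b (X^w + X^u)^c` are products of two binomial coefficients. -/
theorem coeff_pow_mul_pow_le {u v w : σ →₀ ℕ} {x y : σ} {e : ℕ} (he : 0 < e)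
    (hux : u x = 0) (huy : u y = 0) (hvx : v x = e) (hvy : v y = 0) (hwx : w x = 0) (hwy : w y = e)
    (b c : ℕ) (d : σ →₀ ℕ) :
    coeff d ((monomial v (1 : ℝ) + monomial u 1) ^ b * (monomial w (1 : ℝ) + monomial u 1) ^ c) ≤
      (2 : ℝ) ^ b * 2 ^ c * ((1 / (b + 1) + 1 / (c + 1)) / 2) := by
  classical
  rw [monomial_add_monomial_pow, monomial_add_monomial_pow, Finset.sum_mul_sum, coeff_sum]
  simp_rw [coeff_sum, monomial_mul, coeff_monomial]
  have h (i j : ℕ) (hd : i • v + (b - i) • u + (j • w + (c - j) • u) = d) :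
      i = d x / e ∧ j = d y / e := by
    have h1 := DFunLike.congr_fun hd x
    have h2 := DFunLike.congr_fun hd y
    simp [hux, huy, hvx, hvy, hwx, hwy] at h1 h2
    rw [← h1, ← h2]
    simp [Nat.mul_div_cancel _ he]
  have h0 : ∑ i ∈ range (b + 1), ∑ j ∈ range (c + 1),
      (if i • v + (b - i) • u + (j • w + (c - j) • u) = d then
        (b.choose i : ℝ) * c.choose j else 0) ≤
      ∑ i ∈ range (b + 1), ∑ j ∈ range (c + 1),
      (if i = d x / e then if j = d y / e then (b.choose i : ℝ) * c.choose j else 0 else 0) := by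
    refine Finset.sum_le_sum fun i _ => Finset.sum_le_sum fun j _ => ?_
    by_cases hd : i • v + (b - i) • u + (j • w + (c - j) • u) = d
    · rw [if_pos hd, if_pos (h i j hd).1, if_pos (h i j hd).2]
    · rw [if_neg hd]; split_ifs <;> positivity
  refine h0.trans ?_
  refine le_trans ?_ (choose_mul_choose_le b c (d x / e) (d y / e))
  rw [Finset.sum_comm]
  simp only [Finset.sum_ite_eq']
  calc _ ≤ ∑ j ∈ range (c + 1), (if j = d y / e then (b.choose (d x / e) : ℝ) * c.choose j
      else 0) := Finset.sum_le_sum fun j _ => by split_ifs <;> first | positivity | rfl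
    _ ≤ _ := by rw [Finset.sum_ite_eq']; split_ifs <;> first | positivity | rfl

/-- A local limit bound: extracting two independent symmetric two-point steps from each factor,
every coefficient of `P^m` is `O(P(1)^m / m)`. -/
theorem coeff_pow_le {u v w : σ →₀ ℕ} {x y : σ} {e : ℕ} (he : 0 < e)
    (hux : u x = 0) (huy : u y = 0) (hvx : v x = e) (hvy : v y = 0) (hwx : w x = 0) (hwy : w y = e)
    {a : ℝ} (ha : 0 < a) {P : MvPolynomial σ ℝ} (hP : ∀ d, 0 ≤ coeff d P)
    (hPu : 2 * a ≤ coeff u P) (hPv : a ≤ coeff v P) (hPw : a ≤ coeff w P) (m : ℕ) (d : σ →₀ ℕ) :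
    coeff d (P ^ m) ≤ eval (fun _ => 1) P ^ (m + 1) / ((m + 1) * (2 * a)) := by
  classical
  set S := monomial v (1 : ℝ) + monomial u 1 with hS
  set T := monomial w (1 : ℝ) + monomial u 1 with hT
  -- What remains of `P` after the two steps are split off still has nonnegative coefficients.
  set R := P - (C a * S + C a * T) with hR
  have hne : e ≠ 0 := he.ne'
  have huv : u ≠ v := fun h => hne (by rw [← hvx, ← h, hux])
  have huw : u ≠ w := fun h => hne (by rw [← hwy, ← h, huy])
  have hvw : v ≠ w := fun h => hne (by rw [← hvx, h, hwx])
  have hRn (d) : 0 ≤ coeff d R := by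
    simp only [hR, hS, hT, coeff_sub, coeff_add, coeff_C_mul, coeff_monomial]
    rcases eq_or_ne u d with rfl | h1
    · rw [if_neg huv.symm, if_neg huw.symm]; simp; linarith
    rcases eq_or_ne v d with rfl | h2
    · rw [if_neg h1, if_neg hvw.symm]; simp; linarith
    rcases eq_or_ne w d with rfl | h3
    · rw [if_neg h1, if_neg h2]; simp; linarith
    · simp [h1, h2, h3, hP]
  have hev : eval (fun _ => (1 : ℝ)) P = 2 * (2 * a) + eval (fun _ => 1) R := by
    simp [hR, hS, hT, eval_monomial]; ring
  set ρ := eval (fun _ => (1 : ℝ)) R with hρ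
  have hρ0 : 0 ≤ ρ := by
    rw [hρ, eval_eq]; simpa using Finset.sum_nonneg fun e _ => hRn e
  have hexp : P ^ m = ∑ b ∈ range (m + 1), ∑ c ∈ range (m - b + 1),
      C ((m.choose b : ℝ) * (m - b).choose c * (a ^ b * a ^ c)) *
        (S ^ b * T ^ c * R ^ (m - b - c)) := by
    have : P = C a * S + (C a * T + R) := by rw [hR]; ring
    rw [this, add_pow]
    refine Finset.sum_congr rfl fun b _ => ?_
    rw [add_pow, Finset.mul_sum, Finset.sum_mul]
    refine Finset.sum_congr rfl fun c _ => ?_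
    simp only [map_mul, map_pow, map_natCast, mul_pow]
    ring
  rw [hexp, coeff_sum]
  simp_rw [coeff_sum, coeff_C_mul]
  have hterm (b c j : ℕ) : coeff d (S ^ b * T ^ c * R ^ j) ≤
      2 ^ b * 2 ^ c * ((1 / (b + 1) + 1 / (c + 1)) / 2) * ρ ^ j := by
    have := mvCoeff_mul_le (by positivity)
      (coeff_pow_mul_pow_le he hux huy hvx hvy hwx hwy b c) (mvCoeff_pow_nonneg hRn j) d
    rwa [map_pow] at this
  have hfin := sum_choose_choose_le (q := 2 * a) (by positivity) hρ0 m
  rw [← hev] at hfin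
  have : ∑ b ∈ range (m + 1), ∑ c ∈ range (m - b + 1),
      (m.choose b : ℝ) * (m - b).choose c * (a ^ b * a ^ c) *
        coeff d (S ^ b * T ^ c * R ^ (m - b - c)) ≤
      (∑ b ∈ range (m + 1), ∑ c ∈ range (m - b + 1), (m.choose b : ℝ) * (m - b).choose c *
      ((2 * a) ^ b * (2 * a) ^ c) * ρ ^ (m - b - c) * (1 / (b + 1) + 1 / (c + 1))) / 2 := by
    rw [Finset.sum_div]
    refine Finset.sum_le_sum fun b _ => ?_
    rw [Finset.sum_div]
    refine Finset.sum_le_sum fun c _ => ?_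
    refine (mul_le_mul_of_nonneg_left (hterm b c _) (by positivity)).trans (le_of_eq ?_)
    rw [mul_pow, mul_pow]; ring
  linarith

end LocalLimit

end ModThree

namespace ModThree

open Finset MvPolynomial

/-! ### The generating function of `K` -/

/-- The exponent vector of a column or of a triple of row sums. -/
noncomputable abbrev expo (c : Fin 3 → ℕ) : Fin 3 →₀ ℕ := Finsupp.equivFunOnFinite.symm c

/-- The admissible columns: triples with sum `k` and `c_1 ≡ c_2 (mod 3)`. -/
def columns (k : ℕ) : Finset (Fin 3 → ℕ) :=
  (piAntidiag univ k).filter fun c => c 1 ≡ c 2 [MOD 3]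

theorem mem_columns {k : ℕ} {c : Fin 3 → ℕ} : c ∈ columns k ↔ ∑ i, c i = k ∧ c 1 ≡ c 2 [MOD 3] := by
  simp [columns]

/-- The generating polynomial of a single column, evaluated at `x_i X_i`. -/
noncomputable def colPoly (k : ℕ) (x : Fin 3 → ℝ) : MvPolynomial (Fin 3) ℝ :=
  ∑ c ∈ columns k, monomial (expo c) ((Nat.multinomial univ c : ℝ) * ∏ i, x i ^ c i)

theorem prod_monomial {ι σ R : Type*} [CommSemiring R] (s : Finset ι) (e : ι → σ →₀ ℕ) (r : ι → R) :
    ∏ j ∈ s, monomial (e j) (r j) = monomial (∑ j ∈ s, e j) (∏ j ∈ s, r j) := by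
  classical
  induction s using Finset.induction_on with
  | empty => simp
  | insert a s ha ih => rw [prod_insert ha, sum_insert ha, prod_insert ha, ih, monomial_mul]

theorem coeff_colPoly_pow (k m : ℕ) (x : Fin 3 → ℝ) (l : Fin 3 → ℕ) :
    coeff (expo l) (colPoly k x ^ m) = (K k m l : ℝ) * ∏ i, x i ^ l i := by
  classical
  have h : colPoly k x ^ m = ∏ _j : Fin m, colPoly k x := by simp
  have hmat : matrices k m l =
      (Fintype.piFinset fun _ : Fin m => columns k).filter fun κ => ∑ j, expo (κ j) = expo l := by
    ext κ
    simp only [mem_matrices, Finset.mem_filter, Fintype.mem_piFinset, mem_columns]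
    have : ∑ j, expo (κ j) = expo l ↔ ∀ i, ∑ j, κ j i = l i := by
      rw [Finsupp.ext_iff]
      simp [Finsupp.finsetSum_apply]
    rw [this, ← and_assoc, ← forall_and]
  rw [h]
  simp_rw [colPoly]
  rw [Finset.prod_univ_sum, coeff_sum, K, hmat, Finset.sum_filter, Nat.cast_sum, Finset.sum_mul]
  refine Finset.sum_congr rfl fun κ _ => ?_
  rw [prod_monomial, coeff_monomial]
  split_ifs with hκ
  · rw [Finset.prod_mul_distrib, Finset.prod_comm]
    push_cast
    congr 1
    refine Finset.prod_congr rfl fun i _ => ?_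
    rw [Finset.prod_pow_eq_pow_sum]
    congr 1
    simpa [Finsupp.finsetSum_apply] using DFunLike.congr_fun hκ i
  · simp

theorem coeff_colPoly (k : ℕ) (x : Fin 3 → ℝ) (c : Fin 3 → ℕ) :
    coeff (expo c) (colPoly k x) =
      if c ∈ columns k then (Nat.multinomial univ c : ℝ) * ∏ i, x i ^ c i else 0 := by
  classical
  rw [colPoly, coeff_sum]
  simp [coeff_monomial]

theorem coeff_colPoly_nonneg (k : ℕ) {x : Fin 3 → ℝ} (hx : ∀ i, 0 ≤ x i) (d : Fin 3 →₀ ℕ) :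
    0 ≤ coeff d (colPoly k x) := by
  classical
  have : d = expo d := by ext; simp
  rw [this, coeff_colPoly]
  split_ifs
  · exact mul_nonneg (by positivity) (Finset.prod_nonneg fun i _ => pow_nonneg (hx i) _)
  · exact le_rfl

/-- An admissible column has coefficient at least `δ^k` if all `x_i ≥ δ`. -/
theorem le_coeff_colPoly {k : ℕ} {x : Fin 3 → ℝ} {δ : ℝ} (hδ : 0 ≤ δ) (hx : ∀ i, δ ≤ x i)
    {c : Fin 3 → ℕ} (hc : c ∈ columns k) : δ ^ k ≤ coeff (expo c) (colPoly k x) := by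
  rw [coeff_colPoly, if_pos hc]
  have h1 : (1 : ℝ) ≤ Nat.multinomial univ c := by
    exact_mod_cast Nat.multinomial_pos univ c
  calc δ ^ k = ∏ i, δ ^ c i := by rw [Finset.prod_pow_eq_pow_sum, (mem_columns.1 hc).1]
    _ ≤ ∏ i, x i ^ c i := Finset.prod_le_prod (fun i _ => pow_nonneg hδ _)
        fun i _ => pow_le_pow_left₀ hδ (hx i) _
    _ ≤ _ := le_mul_of_one_le_left
        (Finset.prod_nonneg fun i _ => pow_nonneg (hδ.trans (hx i)) _) h1

/-! ### The value at the density vector -/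

/-- The character sum `x_0 + ζ x_1 + ζ² x_2`. -/
noncomputable def charSum (ζ : ℂ) (x : Fin 3 → ℝ) : ℂ := x 0 + ζ * x 1 + ζ ^ 2 * x 2

/-- Detecting `c_1 ≡ c_2 (mod 3)` by the three cube roots of unity. -/
theorem eval_colPoly {ζ : ℂ} (hζ : IsPrimitiveRoot ζ 3) (k : ℕ) (x : Fin 3 → ℝ) :
    ((3 * eval (fun _ => 1) (colPoly k x) : ℝ) : ℂ) =
      charSum 1 x ^ k + charSum ζ x ^ k + charSum (ζ ^ 2) x ^ k := by
  have hsum (η : ℂ) : charSum η x ^ k = ∑ c ∈ piAntidiag univ k,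
      (Nat.multinomial univ c : ℂ) * (∏ i, (x i : ℂ) ^ c i) * η ^ (c 1 + 2 * c 2) := by
    have : charSum η x = ∑ i, ![(x 0 : ℂ), η * x 1, η ^ 2 * x 2] i := by
      simp [Fin.sum_univ_three, charSum]
    rw [this, sum_pow_eq_sum_piAntidiag]
    refine Finset.sum_congr rfl fun c _ => ?_
    simp only [Fin.prod_univ_three, Matrix.cons_val]
    rw [mul_pow, mul_pow, ← pow_mul, pow_add]
    ring
  have h3 : ζ ^ 3 = 1 := hζ.pow_eq_one
  have hgeom : 1 + ζ + ζ ^ 2 = 0 := by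
    have := hζ.geom_sum_eq_zero (by norm_num)
    simpa [Finset.sum_range_succ] using this
  have hroot (c : Fin 3 → ℕ) : 1 + ζ ^ (c 1 + 2 * c 2) + (ζ ^ 2) ^ (c 1 + 2 * c 2) =
      if c 1 ≡ c 2 [MOD 3] then 3 else 0 := by
    have hmod (j : ℕ) : ζ ^ j = ζ ^ (j % 3) := by
      conv_lhs => rw [← Nat.div_add_mod j 3, pow_add, pow_mul, h3, one_pow, one_mul]
    rw [pow_right_comm, hmod (c 1 + 2 * c 2)]
    have hlt := Nat.mod_lt (c 1 + 2 * c 2) (show 0 < 3 by norm_num)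
    have hiff : c 1 ≡ c 2 [MOD 3] ↔ (c 1 + 2 * c 2) % 3 = 0 := by
      unfold Nat.ModEq; omega
    simp only [hiff]
    interval_cases h : (c 1 + 2 * c 2) % 3
    · norm_num
    · simpa using hgeom
    · simp only [OfNat.ofNat_ne_zero, if_false]
      linear_combination hgeom + ζ * h3
  rw [hsum, hsum, hsum, ← Finset.sum_add_distrib, ← Finset.sum_add_distrib, colPoly, columns,
    Finset.sum_filter]
  push_cast
  rw [map_sum, Complex.ofReal_sum, Finset.mul_sum]
  refine Finset.sum_congr rfl fun c _ => ?_
  rw [← mul_add, ← mul_add, one_pow, hroot]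
  split_ifs
  · simp [eval_monomial]; ring
  · simp

theorem eval_colPoly_le {ζ : ℂ} (hζ : IsPrimitiveRoot ζ 3) (k : ℕ) {x : Fin 3 → ℝ}
    (hx1 : ∑ i, x i = 1) {D : ℝ} (hD1 : ‖charSum ζ x‖ ≤ D) (hD2 : ‖charSum (ζ ^ 2) x‖ ≤ D) :
    eval (fun _ => 1) (colPoly k x) ≤ (1 + 2 * D ^ k) / 3 := by
  have h := eval_colPoly hζ k x
  have h1 : charSum 1 x = 1 := by
    rw [Fin.sum_univ_three] at hx1
    simp only [charSum, one_mul, one_pow]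
    exact_mod_cast hx1
  have h2 := (le_abs_self (3 * eval (fun _ => 1) (colPoly k x))).trans_eq (Complex.norm_real _).symm
  rw [h, h1, one_pow] at h2
  have h3 := norm_add₃_le (a := (1 : ℂ)) (b := charSum ζ x ^ k) (c := charSum (ζ ^ 2) x ^ k)
  rw [norm_pow, norm_pow, norm_one] at h3
  have h4 := pow_le_pow_left₀ (norm_nonneg _) hD1 k
  have h5 := pow_le_pow_left₀ (norm_nonneg _) hD2 k
  linarith

/-- The character sum at a primitive root vanishes at the uniform vector, so it is controlled by the
deviation from it. -/
theorem norm_charSum_le {ζ : ℂ} (hζ : IsPrimitiveRoot ζ 3) (x : Fin 3 → ℝ) :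
    ‖charSum ζ x‖ ≤ ∑ i, |x i - 1 / 3| := by
  have hgeom : 1 + ζ + ζ ^ 2 = 0 := by
    have := hζ.geom_sum_eq_zero (by norm_num)
    simpa [Finset.sum_range_succ] using this
  have hn : ‖ζ‖ = 1 := hζ.norm'_eq_one (by norm_num)
  have h : charSum ζ x = ((x 0 - 1 / 3 : ℝ) : ℂ) + ζ * ((x 1 - 1 / 3 : ℝ) : ℂ) +
      ζ ^ 2 * ((x 2 - 1 / 3 : ℝ) : ℂ) := by
    rw [charSum]; push_cast; linear_combination (1 / 3 : ℂ) * hgeom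
  rw [h, Fin.sum_univ_three]
  refine norm_add₃_le.trans (le_of_eq ?_)
  simp only [norm_mul, norm_pow, hn, one_pow, one_mul, Complex.norm_real, Real.norm_eq_abs]

/-! ### Stirling bounds -/

theorem factorial_le_stirling {n : ℕ} (hn : 0 < n) :
    (n.factorial : ℝ) ≤ Real.exp 1 * √n * (n / Real.exp 1) ^ n := by
  obtain ⟨j, rfl⟩ := Nat.exists_eq_succ_of_ne_zero hn.ne'
  have h := Stirling.stirlingSeq'_antitone (Nat.zero_le j)
  simp only [Function.comp, Nat.succ_eq_add_one, zero_add, Stirling.stirlingSeq_one] at h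
  rw [Stirling.stirlingSeq, div_le_iff₀ (by positivity)] at h
  refine h.trans (le_of_eq ?_)
  rw [Real.sqrt_mul (by norm_num)]
  field_simp

theorem stirling_le_factorial (n : ℕ) :
    √n * (n / Real.exp 1) ^ n ≤ (n.factorial : ℝ) := by
  refine le_trans ?_ (Stirling.le_factorial_stirling n)
  gcongr
  have := Real.pi_gt_three
  nlinarith [(Nat.cast_nonneg n : (0 : ℝ) ≤ n)]

/-- The multinomial law with parameters `l_i / L` gives its mean `l̄` a mass of order at least
`1 / L`. -/
theorem one_le_multinomial_mul {l : Fin 3 → ℕ} {L : ℕ} (hl : ∀ i, 0 < l i) (hL : ∑ i, l i = L) :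
    1 ≤ Real.exp 1 ^ 3 * L * (Nat.multinomial univ l * ∏ i, ((l i : ℝ) / L) ^ l i) := by
  have hLpos : 0 < L := by
    rw [← hL, Fin.sum_univ_three]; have := hl 0; omega
  have hLr : (0 : ℝ) < L := by exact_mod_cast hLpos
  have hm : (∏ i, ((l i).factorial : ℝ)) * Nat.multinomial univ l = L.factorial := by
    have := Nat.multinomial_spec (s := univ) (f := l)
    rw [hL] at this
    exact_mod_cast this
  have hfp : (0 : ℝ) < ∏ i, ((l i).factorial : ℝ) :=
    Finset.prod_pos fun i _ => by positivity
  have hle (i : Fin 3) : ((l i).factorial : ℝ) ≤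
      Real.exp 1 * √L * (((l i : ℝ) / L) ^ l i * (L / Real.exp 1) ^ l i) := by
    refine (factorial_le_stirling (hl i)).trans ?_
    have h1 : (l i : ℝ) ≤ L := by
      rw [← hL]; exact_mod_cast Finset.single_le_sum (fun _ _ => Nat.zero_le _) (mem_univ i)
    have h2 : ((l i : ℝ) / L) ^ l i * (L / Real.exp 1) ^ l i = (l i / Real.exp 1) ^ l i := by
      rw [← mul_pow]; congr 1; field_simp
    rw [h2]
    gcongr
  have hprod := Finset.prod_le_prod (s := univ) (fun i _ => by positivity) fun i _ => hle i
  rw [Finset.prod_mul_distrib, Finset.prod_mul_distrib, Finset.prod_mul_distrib,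
    Finset.prod_pow_eq_pow_sum, hL] at hprod
  simp only [Finset.prod_const, Finset.card_univ, Fintype.card_fin] at hprod
  have hst := stirling_le_factorial L
  have hsq : √(L : ℝ) ^ 3 = L * √L := by
    rw [pow_succ, Real.sq_sqrt hLr.le]
  set Q := ∏ i, ((l i : ℝ) / L) ^ l i with hQ
  have hQ0 : 0 ≤ Q := Finset.prod_nonneg fun i _ => by positivity
  have : ∏ i, ((l i).factorial : ℝ) ≤ (∏ i, ((l i).factorial : ℝ)) *
      (Real.exp 1 ^ 3 * L * (Nat.multinomial univ l * Q)) := by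
    calc _ ≤ _ := hprod
      _ = Real.exp 1 ^ 3 * L * Q * (√L * (L / Real.exp 1) ^ L) := by
        rw [hsq]; ring
      _ ≤ Real.exp 1 ^ 3 * L * Q * L.factorial := by gcongr
      _ = _ := by rw [← hm]; ring
  exact le_of_mul_le_mul_left (by simpa using this) hfp

/-! ### Comparison of `K` with the multinomial coefficient -/

/-- Up to a constant factor and a factor controlled by the deviation of `l̄` from uniformity,
`K(l̄)` is at most the share `3^{-m}` of the full multinomial coefficient. -/
theorem K_le {k m : ℕ} (hk : 3 ≤ k) {l : Fin 3 → ℕ} (hL : ∑ i, l i = k * m) (hm : 0 < m)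
    (hl : ∀ i, (1 / 6 : ℝ) ≤ (l i : ℝ) / (k * m : ℕ))
    (hD : ∑ i, |(l i : ℝ) / (k * m : ℕ) - 1 / 3| ≤ 1) :
    (K k m l : ℝ) ≤ Real.exp 1 ^ 3 * k * 6 ^ k / 3 ^ m *
      Real.exp (2 * m * (∑ i, |(l i : ℝ) / (k * m : ℕ) - 1 / 3|) ^ k) * Nat.multinomial univ l := by
  set x : Fin 3 → ℝ := fun i => (l i : ℝ) / (k * m : ℕ) with hx
  set D := ∑ i, |x i - 1 / 3| with hDdef
  have hD0 : 0 ≤ D := Finset.sum_nonneg fun _ _ => abs_nonneg _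
  have hkm : 0 < k * m := by positivity
  have hlpos (i : Fin 3) : 0 < l i := by
    by_contra h
    have h0 : l i = 0 := by omega
    have := hl i
    rw [h0] at this
    norm_num at this
  have hx1 : ∑ i, x i = 1 := by
    simp only [hx, ← Finset.sum_div]
    rw [← Nat.cast_sum, hL, div_self]
    exact_mod_cast hkm.ne'
  obtain ⟨ζ, hζ⟩ : ∃ ζ : ℂ, IsPrimitiveRoot ζ 3 := ⟨_, Complex.isPrimitiveRoot_exp 3 (by norm_num)⟩
  have hζ2 : IsPrimitiveRoot (ζ ^ 2) 3 := hζ.pow_of_coprime 2 (by norm_num)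
  have hev := eval_colPoly_le hζ k hx1 (norm_charSum_le hζ x) (norm_charSum_le hζ2 x)
  rw [← hDdef] at hev
  have hc (c : Fin 3 → ℕ) (hc : c ∈ columns k) := le_coeff_colPoly (x := x) (by norm_num) hl hc
  have hP0 := coeff_colPoly_nonneg k (x := x) fun i => (by norm_num : (0 : ℝ) ≤ 1 / 6).trans (hl i)
  have hev0 : 0 ≤ eval (fun _ => (1 : ℝ)) (colPoly k x) := by
    rw [eval_eq]; simpa using Finset.sum_nonneg fun e _ => hP0 e
  -- The admissible columns `(k,0,0)`, `(k-3,3,0)`, `(k-3,0,3)` have independent differences. The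
  -- first serves in both two-point steps, hence the factor `1 / 2` in `a`.
  have hmain := coeff_pow_le (u := expo ![k, 0, 0]) (v := expo ![k - 3, 3, 0])
    (w := expo ![k - 3, 0, 3]) (x := 1) (y := 2) (e := 3) (by norm_num) (by simp) (by simp)
    (by simp) (by simp) (by simp) (by simp) (a := (1 / 6 : ℝ) ^ k / 2) (by positivity) hP0
    (by
      have := hc ![k, 0, 0] (by rw [mem_columns]; simp [Fin.sum_univ_three, Nat.ModEq])
      linarith)
    (by
      have h0 : (0 : ℝ) < (1 / 6 : ℝ) ^ k := by positivity
      have := hc ![k - 3, 3, 0]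
        (by rw [mem_columns]; simp [Fin.sum_univ_three, Nat.ModEq]; omega)
      linarith)
    (by
      have h0 : (0 : ℝ) < (1 / 6 : ℝ) ^ k := by positivity
      have := hc ![k - 3, 0, 3]
        (by rw [mem_columns]; simp [Fin.sum_univ_three, Nat.ModEq]; omega)
      linarith) m (expo l)
  rw [coeff_colPoly_pow, mul_div_cancel₀ _ (two_ne_zero' ℝ)] at hmain
  have hDk : D ^ k ≤ 1 := pow_le_one₀ hD0 hD
  have hpow : eval (fun _ => (1 : ℝ)) (colPoly k x) ^ (m + 1) ≤
      Real.exp (2 * m * D ^ k) / 3 ^ m := by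
    calc eval (fun _ => (1 : ℝ)) (colPoly k x) ^ (m + 1)
        ≤ ((1 + 2 * D ^ k) / 3) ^ (m + 1) := pow_le_pow_left₀ hev0 hev _
      _ ≤ ((1 + 2 * D ^ k) / 3) ^ m :=
          pow_le_pow_of_le_one (by positivity) (by linarith) (Nat.le_succ m)
      _ = (1 + 2 * D ^ k) ^ m / 3 ^ m := div_pow _ _ _
      _ ≤ Real.exp (2 * D ^ k) ^ m / 3 ^ m := by
          gcongr; linarith [Real.add_one_le_exp (2 * D ^ k)]
      _ = _ := by rw [← Real.exp_nat_mul]; congr 2; ring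
  have hone := one_le_multinomial_mul hlpos hL
  set Q := ∏ i, ((l i : ℝ) / (k * m : ℕ)) ^ l i with hQ
  have hmr : (0 : ℝ) < m := by exact_mod_cast hm
  have hKQ : (K k m l : ℝ) * Q ≤ Real.exp (2 * m * D ^ k) / 3 ^ m * 6 ^ k / m := by
    refine hmain.trans ?_
    rw [one_div, inv_pow]
    calc _ ≤ Real.exp (2 * m * D ^ k) / 3 ^ m / (m * (6 ^ k : ℝ)⁻¹) := by
          gcongr; linarith
      _ = _ := by field_simp
  calc (K k m l : ℝ) ≤ K k m l *
        (Real.exp 1 ^ 3 * (k * m : ℕ) * (Nat.multinomial univ l * Q)) :=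
        le_mul_of_one_le_right (by positivity) hone
    _ = (K k m l * Q) * (Real.exp 1 ^ 3 * (k * m : ℕ) * Nat.multinomial univ l) := by ring
    _ ≤ (Real.exp (2 * m * D ^ k) / 3 ^ m * 6 ^ k / m) *
        (Real.exp 1 ^ 3 * (k * m : ℕ) * Nat.multinomial univ l) := by gcongr
    _ = _ := by push_cast; field_simp

end ModThree

namespace ModThree

open Finset

/-! ### Combination of the estimates -/

theorem exp_avg_le_sum_exp (z : Fin 3 → ℝ) : Real.exp ((∑ j, z j) / 3) ≤ ∑ j, Real.exp (z j) := by
  obtain ⟨j, hj⟩ : ∃ j, (∑ i, z i) / 3 ≤ z j := by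
    by_contra! h
    have := Finset.sum_lt_sum_of_nonempty univ_nonempty fun j (_ : j ∈ univ) => h j
    simp at this
    linarith
  exact (Real.exp_le_exp.2 hj).trans
    (Finset.single_le_sum (fun i _ => (Real.exp_pos (z i)).le) (mem_univ j))

/-- The sub-Gaussian bound in squared form, for the deviation of a single class size. -/
theorem sum_freeWeight_mul_exp_sq_le {B : ℝ} (hB1 : 1 ≤ B) {L n : ℕ} (hn : 2 ≤ n)
    (hLB : (L : ℝ) ≤ B * n) (hB : (L : ℝ) ≤ B * ((n - 1 : ℕ) * Real.exp (-1))) (j : Fin 3) :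
    ∑ p ∈ allPairs L n, freeWeight p *
      Real.exp (((p.2 j : ℝ) - L / 3) ^ 2 / (8 * (2 * Real.exp (4 * Real.exp 1 * B) * n))) ≤
      √2 * (3 ^ n * (M L n : ℝ)) := by
  set a : Fin 3 → ℝ := fun i => (if i = j then 1 else 0) - 1 / 3 with ha
  have ha0 : ∑ i, a i = 0 := by simp [ha]
  have ha1 (i : Fin 3) : |a i| ≤ 1 := by
    simp only [ha]; rw [abs_le]; split_ifs <;> norm_num
  have hn0 : (0 : ℝ) < n := by exact_mod_cast (by omega : 0 < n)
  refine le_trans (le_of_eq (Finset.sum_congr rfl fun p hp => ?_))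
    (sum_exp_sq_le_of_subgaussian (allPairs L n) freeWeight (fun p => ∑ i, a i * p.2 i)
      (by positivity) (sum_freeWeight_mul_exp_le ha0 ha1 hB1 hn hLB hB))
  have hL : ∑ i, (p.2 i : ℝ) = L := by exact_mod_cast (mem_allPairs.1 hp).2
  have : ∑ i, a i * (p.2 i : ℝ) = p.2 j - L / 3 := by
    simp only [ha, sub_mul, Finset.sum_sub_distrib, ← Finset.mul_sum, hL]
    simp; ring
  rw [this]

theorem N_le_mul_freeWeight {k m : ℕ} {p : (Fin 3 → ℕ) × (Fin 3 → ℕ)} {A : ℝ}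
    (h : (K k m p.2 : ℝ) ≤ A * Nat.multinomial univ p.2) :
    (N k m p.1 p.2 : ℝ) ≤ A * freeWeight p := by
  rw [N, Nhat, freeWeight]
  push_cast
  calc (Nat.multinomial univ p.1 : ℝ) * (K k m p.2 * ∏ i, (M (p.2 i) (p.1 i) : ℝ))
      ≤ (Nat.multinomial univ p.1 : ℝ) *
        ((A * Nat.multinomial univ p.2) * ∏ i, (M (p.2 i) (p.1 i) : ℝ)) := by gcongr
    _ = _ := by ring

/-- In a small window the correction factor in `K_le` is dominated by the exponential of a small
multiple of the squared deviations, because `k ≥ 3`. -/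
theorem exponent_le {k m n : ℕ} (hk : 3 ≤ k) (hm : 0 < m) (hn : 0 < n) (hnL : 2 * n ≤ k * m)
    {ε : ℝ} {y : Fin 3 → ℝ}
    (hD1 : ∑ i, |y i / (k * m : ℕ) - 1 / 3| ≤ 4 * ε) (hε1 : 4 * ε ≤ 1) :
    2 * m * (∑ i, |y i / (k * m : ℕ) - 1 / 3|) ^ k ≤
      4 * ε * (∑ i, (y i - (k * m : ℕ) / 3) ^ 2) / n := by
  set D := ∑ i, |y i / (k * m : ℕ) - 1 / 3| with hD
  have hD0 : 0 ≤ D := Finset.sum_nonneg fun _ _ => abs_nonneg _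
  have hL0 : (0 : ℝ) < (k * m : ℕ) := by exact_mod_cast (by positivity : 0 < k * m)
  have hLk : ((k * m : ℕ) : ℝ) = k * m := by push_cast; ring
  have hk3 : (3 : ℝ) ≤ k := by exact_mod_cast hk
  have hmr : (0 : ℝ) < m := by exact_mod_cast hm
  have hnr : (0 : ℝ) < n := by exact_mod_cast hn
  have hnL' : 2 * (n : ℝ) ≤ (k * m : ℕ) := by exact_mod_cast hnL
  set L : ℝ := ((k * m : ℕ) : ℝ) with hLdef
  set Y := ∑ i, (y i - L / 3) ^ 2 with hY
  have hY0 : 0 ≤ Y := Finset.sum_nonneg fun _ _ => sq_nonneg _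
  have hD2 : D ^ 2 ≤ 3 * (Y / L ^ 2) := by
    have h := sq_sum_le_card_mul_sum_sq (s := univ) (f := fun i => |y i / L - 1 / 3|)
    simp only [sq_abs, Finset.card_univ, Fintype.card_fin] at h
    refine h.trans (le_of_eq ?_)
    rw [hY, Finset.sum_div]
    push_cast
    congr 1
    refine Finset.sum_congr rfl fun i _ => ?_
    field_simp
  have hDk : D ^ k ≤ 4 * ε * D ^ 2 := by
    calc D ^ k ≤ D ^ 3 := pow_le_pow_of_le_one hD0 (hD1.trans hε1) hk
      _ = D * D ^ 2 := by ring
      _ ≤ _ := by gcongr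
  have hε0 : 0 ≤ 4 * ε := hD0.trans hD1
  have hfrac : 2 * m * (3 * (Y / L ^ 2)) ≤ Y / n := by
    rw [← mul_div_assoc, ← mul_div_assoc, div_le_div_iff₀ (by positivity) hnr]
    have h1 : 2 * (m : ℝ) * 3 * n ≤ L ^ 2 := by
      have h3 : 3 * (m : ℝ) ≤ L := by rw [hLk]; gcongr
      nlinarith
    nlinarith [mul_le_mul_of_nonneg_left h1 hY0]
  calc 2 * m * D ^ k ≤ 2 * m * (4 * ε * (3 * (Y / L ^ 2))) := by
        gcongr; exact hDk.trans (by gcongr)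
    _ = 4 * ε * (2 * m * (3 * (Y / L ^ 2))) := by ring
    _ ≤ 4 * ε * (Y / n) := by gcongr
    _ = _ := by ring

end ModThree

theorem mainTheorem6 (k : ℕ) (hk : 3 ≤ k) (γ₀ γ₁ : ℝ) (hγ₀ : 2 < (k : ℝ) * γ₀) (hγ₁ : γ₁ < 1) :
    ∃ ε : ℝ, 0 < ε ∧ ∃ C : ℝ, 0 < C ∧
      ∀ (γ : ℝ) (n m : ℕ), γ₀ ≤ γ → γ ≤ γ₁ → 1 ≤ n → (m : ℝ) = γ * (n : ℝ) →
        ∑ p ∈ ModThree.localPairs ε k m n,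
            (ModThree.N k m p.1 p.2 : ℝ) / (ModThree.N₀ k m n : ℝ) <
          C * (3 : ℝ) ^ ((1 - γ) * (n : ℝ)) := by
  open ModThree Finset in
  have hk3 : (3 : ℝ) ≤ k := by exact_mod_cast hk
  have he2 : (2 : ℝ) ≤ Real.exp 1 := by linarith [Real.add_one_le_exp (1 : ℝ)]
  -- `B (n - 1) / e = 2 k (n - 1)` is at least `k n`, which bounds the number `k m` of slots.
  set B : ℝ := 2 * k * Real.exp 1 with hBdef
  have hB1 : 1 ≤ B := by rw [hBdef]; nlinarith
  set c := 2 * Real.exp (4 * Real.exp 1 * B) with hc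
  have hc2 : 2 ≤ c := by
    have : 1 ≤ Real.exp (4 * Real.exp 1 * B) := Real.one_le_exp (by positivity)
    linarith
  -- With this `ε` the exponent `4 ε Y / n` is the average of the three exponents `Y_j / (8 c n)`.
  set ε := 1 / (96 * c) with hε
  have hε0 : 0 < ε := by positivity
  have hε12 : ε ≤ 1 / 12 := by
    rw [hε]; gcongr; linarith
  set A := Real.exp 1 ^ 3 * k * 6 ^ k with hA
  have hA0 : 0 < A := by positivity
  refine ⟨ε, hε0, 3 * √2 * A + 1, by positivity, ?_⟩
  intro γ n m h0 h1 hn hm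
  have hnr : (0 : ℝ) < n := by exact_mod_cast hn
  have hkγ : 2 < k * γ := hγ₀.trans_le (by gcongr)
  have hγ : 0 < γ := by
    by_contra h
    nlinarith
  have hmr : (0 : ℝ) < m := by rw [hm]; positivity
  have hm0 : 0 < m := by exact_mod_cast hmr
  have hmn : m < n := by
    have : (m : ℝ) < n := by rw [hm]; nlinarith
    exact_mod_cast this
  have hn2 : 2 ≤ n := by omega
  set L := k * m with hL
  have hLr : (L : ℝ) = k * m := by rw [hL]; push_cast; ring
  have hnL : 2 * n ≤ L := by
    have : 2 * (n : ℝ) ≤ L := by rw [hLr, hm]; nlinarith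
    exact_mod_cast this
  have hLn : (L : ℝ) ≤ k * n := by
    rw [hLr]; gcongr
  have hLB : (L : ℝ) ≤ B * n := by
    refine hLn.trans ?_
    gcongr
    rw [hBdef]; nlinarith
  have hB : (L : ℝ) ≤ B * ((n - 1 : ℕ) * Real.exp (-1)) := by
    have h2 : B * ((n - 1 : ℕ) * Real.exp (-1)) = k * (2 * (n - 1 : ℕ)) := by
      rw [hBdef, Real.exp_neg]; field_simp
    rw [h2]
    refine hLn.trans ?_
    gcongr
    exact_mod_cast (by omega : n ≤ 2 * (n - 1))
  have hsub : localPairs ε k m n ⊆ allPairs L n := by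
    rintro ⟨w, l⟩ hp
    exact mem_allPairs.2 (mem_localPairs.1 hp).1
  have hpt (p) (hp : p ∈ localPairs ε k m n) : (N k m p.1 p.2 : ℝ) ≤ A / 3 ^ m *
      ∑ j, freeWeight p * Real.exp (((p.2 j : ℝ) - L / 3) ^ 2 / (8 * (c * n))) := by
    obtain ⟨⟨-, hl⟩, -, hl1, hl2⟩ := mem_localPairs.1 hp
    rw [← hL] at hl
    rw [← hLr] at hl1 hl2
    set x : Fin 3 → ℝ := fun i => (p.2 i : ℝ) / L with hx
    have hx1 : ∑ i, x i = 1 := by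
      simp only [hx, ← Finset.sum_div]
      rw [← Nat.cast_sum, hl, div_self]
      rw [hLr]; positivity
    rw [Fin.sum_univ_three] at hx1
    change |x 1 - 1 / 3| < ε at hl1
    change |x 2 - 1 / 3| < ε at hl2
    have hl1' := abs_lt.1 hl1
    have hl2' := abs_lt.1 hl2
    have hl0 : |x 0 - 1 / 3| ≤ 2 * ε := by rw [abs_le]; constructor <;> linarith
    have hl0' := abs_le.1 hl0
    have hlow (i : Fin 3) : (1 / 6 : ℝ) ≤ x i := by
      fin_cases i
      · change 1 / 6 ≤ x 0; linarith
      · change 1 / 6 ≤ x 1; linarith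
      · change 1 / 6 ≤ x 2; linarith
    have hD : ∑ i, |x i - 1 / 3| ≤ 4 * ε := by rw [Fin.sum_univ_three]; linarith
    have hK := K_le hk hl hm0 hlow (hD.trans (by linarith))
    have hexp := exponent_le (y := fun i => (p.2 i : ℝ)) hk hm0 hn hnL hD (by linarith)
    have havg : 4 * ε * (∑ i, ((p.2 i : ℝ) - L / 3) ^ 2) / n =
        (∑ i, ((p.2 i : ℝ) - L / 3) ^ 2 / (8 * (c * n))) / 3 := by
      rw [← Finset.sum_div, hε]
      generalize ∑ i, ((p.2 i : ℝ) - L / 3) ^ 2 = Y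
      field_simp; ring
    have h3 := (Real.exp_le_exp.2 (hexp.trans_eq havg)).trans (exp_avg_le_sum_exp _)
    have h4 := mul_le_mul_of_nonneg_left h3 (show 0 ≤ A / 3 ^ m by positivity)
    have h5 := N_le_mul_freeWeight (hK.trans (mul_le_mul_of_nonneg_right h4 (by positivity)))
    refine h5.trans (le_of_eq ?_)
    rw [← Finset.mul_sum]; ring
  have hsum : ∑ p ∈ localPairs ε k m n, (N k m p.1 p.2 : ℝ) ≤
      3 * √2 * A * (3 ^ n / 3 ^ m) * M L n := by
    calc _ ≤ ∑ p ∈ localPairs ε k m n, A / 3 ^ m *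
          ∑ j, freeWeight p * Real.exp (((p.2 j : ℝ) - L / 3) ^ 2 / (8 * (c * n))) :=
          Finset.sum_le_sum hpt
      _ ≤ ∑ p ∈ allPairs L n, A / 3 ^ m *
          ∑ j, freeWeight p * Real.exp (((p.2 j : ℝ) - L / 3) ^ 2 / (8 * (c * n))) :=
          Finset.sum_le_sum_of_subset_of_nonneg hsub fun p _ _ =>
            mul_nonneg (by positivity) (Finset.sum_nonneg fun j _ =>
              mul_nonneg (freeWeight_nonneg p) (Real.exp_pos _).le)
      _ = A / 3 ^ m * ∑ j, ∑ p ∈ allPairs L n,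
          freeWeight p * Real.exp (((p.2 j : ℝ) - L / 3) ^ 2 / (8 * (c * n))) := by
          rw [← Finset.mul_sum, Finset.sum_comm]
      _ ≤ A / 3 ^ m * ∑ _j : Fin 3, √2 * (3 ^ n * (M L n : ℝ)) := by
          gcongr with j
          exact sum_freeWeight_mul_exp_sq_le hB1 hn2 hLB hB j
      _ = _ := by simp; ring
  have hrpow : (3 : ℝ) ^ ((1 - γ) * (n : ℝ)) = 3 ^ n / 3 ^ m := by
    rw [show (1 - γ) * (n : ℝ) = n - m by rw [hm]; ring, Real.rpow_sub (by norm_num),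
      Real.rpow_natCast, Real.rpow_natCast]
  rw [← Finset.sum_div, hrpow]
  have hpos : (0 : ℝ) < 3 ^ n / 3 ^ m := by positivity
  -- No positivity of `N₀` is needed here: a quotient by `0` would be `0`.
  calc _ ≤ 3 * √2 * A * (3 ^ n / 3 ^ m) :=
        div_le_of_le_mul₀ (Nat.cast_nonneg _) (by positivity) hsum
    _ < _ := by linarith
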